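/- Fix a finite vertex set $V$ with $n=|V|$ and two distinct terminals $s,t\in V$. All graphs are simple, undirected and unweighted on $V$, and $\nu(\mathcal G)$ denotes the minimum size $|E_{\mathcal G}(S,V\setminus S)|$ over all $S\subseteq V$ with $s\in S$, $t\notin S$ (equivalently, the maximum $s$-$t$ flow value). For graphs on $V$, $H\preceq G$ means $E_H\subseteq E_G$. In the two-party communication model Alice knows a graph $G_A=(V,E_A)$ and Bob knows a graph $G_B=(V,E_B)$, the input graph is $G=(V,E_A\cup E_B)$, the players announce one bit at a time, the transcript so far determining who speaks and each bit depending only on the speaker's graph, the public information and the transcript, with unlimited local computation, and the output is determined by the public information and the transcript. There are absolute constants $C$ and $d$ such that the following holds for all such $V$, $s$, $t$. Let $f,k,k'$ be publicly known integers with $1\le k'<k\le f$, and let $H$ be a publicly known graph on $V$ with $\nu(H)\ge f-k$. Then there is a deterministic two-party protocol that communicates at most $C\cdot nf\cdot\frac{\sqrt k}{k'}\cdot(\log n)^d$ bits, i.e. $\widetilde O\!\left(nf\cdot\frac{\sqrt k}{k'}\right)$ bits, and that, for all inputs $G_A,G_B$ whose union $G$ satisfies $H\preceq G$ and $\nu(G)\ge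 f$, outputs a graph $H^{\mathrm{after}}\preceq G$ with $\nu(H^{\mathrm{after}})\ge f-k'$. -/

import Mathlib

/-- A deterministic two-party communication protocol, as a finite binary tree. Alice holds an input
in `X`, Bob holds an input in `Y`. At an internal node one of the players announces one bit, computed
from that player's own input (and the transcript so far, which is the position in the tree); the
result, at a leaf, is determined by the transcript and hence known to both players. -/
inductive CommProtocol (X Y Z : Type*) where
  | output (z : Z) : CommProtocol X Y Z
  | alice (msg : X → Bool) (next : Bool → CommProtocol X Y Z) : CommProtocol X Y Z
  | bob (msg : Y → Bool) (next : Bool → CommProtocol X Y Z) : CommProtocol X Y Z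

/-- The result of running the protocol on Alice's input `x` and Bob's input `y`. -/
def CommProtocol.run {X Y Z : Type*} : CommProtocol X Y Z → X → Y → Z
  | .output z, _, _ => z
  | .alice msg next, x, y => (next (msg x)).run x y
  | .bob msg next, x, y => (next (msg y)).run x y

/-- The communication cost of the protocol: the worst-case number of bits exchanged, that is, the
height of the tree. -/
def CommProtocol.cost {X Y Z : Type*} : CommProtocol X Y Z → ℕ
  | .output _ => 0
  | .alice _ next => max (next false).cost (next true).cost + 1
  | .bob _ next => max (next false).cost (next true).cost + 1

/-- The size `|E_G(S, T)|` of the cut `(S, T)` with `T` the complement of `S`: each crossing edge is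
counted once, through its endpoint pair `(a, b)` with `a ∈ S` and `b ∈ T`. -/
noncomputable def cutSize {V : Type*} (G : SimpleGraph V) (S : Set V) : ℕ :=
  {p : V × V | p.1 ∈ S ∧ p.2 ∉ S ∧ G.Adj p.1 p.2}.ncard

/-- The minimum size of an `s`-`t` cut of the undirected unweighted graph `G`. -/
noncomputable def minCutValue {V : Type*} (G : SimpleGraph V) (s t : V) : ℕ :=
  sInf {c : ℕ | ∃ S : Set V, s ∈ S ∧ t ∉ S ∧ cutSize G S = c}

/-! Deficit means `f` minus the smallest `s`-`t` cut of the public graph. One round of about `n√k`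
bits, up to logarithms, multiplies the deficit by `1 - Ω(1/log n)`, so polylogarithmically many
rounds bring it to zero. Since `f / k' ≥ 1`, reaching zero fits the stated budget, and the protocol
does not depend on `k'`. In a round Bob sends a sketch of his edges outside `H`: a submodular set
function that dominates their cut sizes and exceeds them by at most a logarithmic factor
(`exists_sketch`). Alice sends a sparse set of her edges that, with `H` and the sketch, lifts every
`s`-`t` cut to `f`. On a cut that is still short the sketch is large, so Bob's true edges cover a
logarithmic fraction of the shortage, and a sparse set of them secures that gain
(`canImprove_step`). Sparsity is `exists_sparse_augmentation`: in a minimal augmentation every edge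
crosses a tight set, tight sets form a lattice by submodularity, and each is crossed by at most `κ`
edges. A chain in the lattice then bounds the number of edges by `O(n√κ)`. The sketch must be
submodular for this to apply to Alice's message. -/

/-! ### Submodular functions and elementary cut estimates -/

/-- A set function is submodular. -/
def IsSubmodular {V : Type*} (h : Set V → ℕ) : Prop :=
  ∀ X Y : Set V, h (X ∩ Y) + h (X ∪ Y) ≤ h X + h Y

theorem IsSubmodular.add {V : Type*} {g h : Set V → ℕ} (hg : IsSubmodular g)
    (hh : IsSubmodular h) : IsSubmodular (fun X => g X + h X) := by
  intro X Y
  have := hg X Y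
  have := hh X Y
  simp only
  omega

theorem IsSubmodular.const {V : Type*} (c : ℕ) : IsSubmodular (fun _ : Set V => c) :=
  fun _ _ => le_rfl

theorem IsSubmodular.sum {V ι : Type*} {g : ι → Set V → ℕ} (s : Finset ι)
    (hg : ∀ i ∈ s, IsSubmodular (g i)) : IsSubmodular (fun X => ∑ i ∈ s, g i X) := by
  intro X Y
  simp only [← Finset.sum_add_distrib]
  exact Finset.sum_le_sum fun i hi => hg i hi X Y

theorem le_minCutValue_iff {V : Type*} (G : SimpleGraph V) {s t : V} (hst : s ≠ t) (f : ℕ) :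
    f ≤ minCutValue G s t ↔ ∀ S : Set V, s ∈ S → t ∉ S → f ≤ cutSize G S := by
  constructor
  · intro h S hs ht
    exact h.trans (Nat.sInf_le ⟨S, hs, ht, rfl⟩)
  · intro h
    have hne : {c : ℕ | ∃ S : Set V, s ∈ S ∧ t ∉ S ∧ cutSize G S = c}.Nonempty :=
      ⟨_, {s}, rfl, fun h => hst h.symm, rfl⟩
    obtain ⟨S, hs, ht, hc⟩ := Nat.sInf_mem hne
    rw [minCutValue, ← hc]
    exact h S hs ht

section Cuts

variable {V : Type*} [Fintype V]

open Classical in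
theorem cutSize_eq_card (G : SimpleGraph V) (S : Set V) :
    cutSize G S = (Finset.univ.filter fun p : V × V => p.1 ∈ S ∧ p.2 ∉ S ∧ G.Adj p.1 p.2).card := by
  rw [cutSize, ← Set.ncard_coe_finset]
  simp

theorem cutSize_submodular (G : SimpleGraph V) : IsSubmodular (cutSize G) := by
  classical
  intro X Y
  simp only [cutSize_eq_card, Finset.card_filter, ← Finset.sum_add_distrib]
  refine Finset.sum_le_sum fun p _ => ?_
  by_cases h1 : p.1 ∈ X <;> by_cases h2 : p.1 ∈ Y <;> by_cases h3 : p.2 ∈ X <;>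
    by_cases h4 : p.2 ∈ Y <;> by_cases h5 : G.Adj p.1 p.2 <;> simp [h1, h2, h3, h4, h5]

theorem cutSize_mono {G G' : SimpleGraph V} (h : G ≤ G') (S : Set V) :
    cutSize G S ≤ cutSize G' S :=
  Set.ncard_le_ncard (fun _ hp => ⟨hp.1, hp.2.1, h hp.2.2⟩) (Set.toFinite _)

theorem cutSize_sup_le (G G' : SimpleGraph V) (S : Set V) :
    cutSize (G ⊔ G') S ≤ cutSize G S + cutSize G' S := by
  refine le_trans (Set.ncard_le_ncard ?_ (Set.toFinite _)) (Set.ncard_union_le _ _)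
  rintro p ⟨h1, h2, h3⟩
  rcases h3 with h3 | h3
  · exact Or.inl ⟨h1, h2, h3⟩
  · exact Or.inr ⟨h1, h2, h3⟩

theorem cutSize_add_le_sup {G G' : SimpleGraph V} (h : Disjoint G G') (S : Set V) :
    cutSize G S + cutSize G' S ≤ cutSize (G ⊔ G') S := by
  rw [cutSize, cutSize, ← Set.ncard_union_eq]
  · refine Set.ncard_le_ncard ?_ (Set.toFinite _)
    rintro p (⟨h1, h2, h3⟩ | ⟨h1, h2, h3⟩)
    · exact ⟨h1, h2, Or.inl h3⟩
    · exact ⟨h1, h2, Or.inr h3⟩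
  · rw [Set.disjoint_left]
    rintro p ⟨_, _, h3⟩ ⟨_, _, h3'⟩
    have : (G ⊓ G').Adj p.1 p.2 := ⟨h3, h3'⟩
    rw [h.eq_bot] at this
    exact this

/-- The cut `{s}` is bounded by the degree of `s`. This makes the promise on `G` unsatisfiable when
`f ≥ n`, so only deficits below `n` matter. -/
theorem minCutValue_lt_card (G : SimpleGraph V) {s t : V} (hst : s ≠ t) :
    minCutValue G s t < Fintype.card V := by
  classical
  have h : minCutValue G s t ≤ cutSize G {s} :=
    (le_minCutValue_iff G hst _).1 le_rfl _ rfl fun h => hst h.symm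
  refine h.trans_lt ?_
  have : cutSize G {s} ≤ ((Finset.univ.erase s).image fun v => (s, v)).card := by
    rw [cutSize_eq_card]
    refine Finset.card_le_card ?_
    rintro ⟨u, v⟩ hp
    simp only [Finset.mem_filter, Finset.mem_univ, true_and, Set.mem_singleton_iff] at hp
    simp only [Finset.mem_image, Finset.mem_erase, Finset.mem_univ, and_true]
    exact ⟨v, hp.2.1, by rw [hp.1]⟩
  have h2 := Finset.card_image_le (s := Finset.univ.erase s) (f := fun v : V => (s, v))
  rw [Finset.card_erase_of_mem (Finset.mem_univ s), Finset.card_univ] at h2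
  have : 0 < Fintype.card V := Fintype.card_pos_iff.2 ⟨s⟩
  omega

/-- The number of ordered pairs of adjacent vertices, which is twice the number of edges. -/
noncomputable def dartCount (G : SimpleGraph V) : ℕ :=
  {p : V × V | G.Adj p.1 p.2}.ncard

open Classical in
theorem dartCount_eq_card (G : SimpleGraph V) :
    dartCount G = (Finset.univ.filter fun p : V × V => G.Adj p.1 p.2).card := by
  rw [dartCount, ← Set.ncard_coe_finset]
  simp

end Cuts

/-! ### Sparsity of minimal augmentations -/

/-- A finite lattice of sets contains a chain that separates every pair of points separated by a
member of the lattice. -/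
theorem exists_separating_chain {V : Type*} [Finite V] (T : Set (Set V)) (h_empty : ∅ ∈ T)
    (h_univ : Set.univ ∈ T) (h_inter : ∀ X ∈ T, ∀ Y ∈ T, X ∩ Y ∈ T)
    (h_union : ∀ X ∈ T, ∀ Y ∈ T, X ∪ Y ∈ T) :
    ∃ K ⊆ T, IsChain (· ⊆ ·) K ∧ ∅ ∈ K ∧ Set.univ ∈ K ∧
      ∀ X ∈ T, ∀ u ∈ X, ∀ v ∉ X, ∃ C ∈ K, (u ∈ C ∧ v ∉ C) ∨ (v ∈ C ∧ u ∉ C) := by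
  obtain ⟨K, ⟨hKT, hK⟩, hmax⟩ :=
    Set.Finite.exists_maximal (s := {K : Set (Set V) | K ⊆ T ∧ IsChain (· ⊆ ·) K})
      (Set.toFinite _) ⟨∅, by simp, by simp [IsChain]⟩
  have key : ∀ X ∈ T, (∀ C ∈ K, X ⊆ C ∨ C ⊆ X) → X ∈ K := by
    intro X hX hcmp
    have h1 : insert X K ∈ {K : Set (Set V) | K ⊆ T ∧ IsChain (· ⊆ ·) K} :=
      ⟨Set.insert_subset hX hKT, hK.insert fun C hC _ => hcmp C hC⟩
    exact hmax h1 (Set.subset_insert _ _) (Set.mem_insert _ _)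
  have h0 : ∅ ∈ K := key ∅ h_empty fun C _ => Or.inl (Set.empty_subset _)
  have h1 : Set.univ ∈ K := key _ h_univ fun C _ => Or.inr (Set.subset_univ _)
  refine ⟨K, hKT, hK, h0, h1, ?_⟩
  intro X hX u hu v hv
  by_contra! hcon
  obtain ⟨L, ⟨hLK, huL, hvL⟩, hLmax⟩ :=
    Set.Finite.exists_maximal (s := {C | C ∈ K ∧ u ∉ C ∧ v ∉ C}) (Set.toFinite _)
      ⟨∅, h0, by simp, by simp⟩
  obtain ⟨U, ⟨hUK, huU, hvU⟩, hUmin⟩ :=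
    Set.Finite.exists_minimal (s := {C | C ∈ K ∧ u ∈ C ∧ v ∈ C}) (Set.toFinite _)
      ⟨Set.univ, h1, by simp, by simp⟩
  have hLU : L ⊆ U := by
    rcases hK.total hLK hUK with h | h
    · exact h
    · exact absurd (h huU) huL
  -- If no chain member separates `u` from `v`, each one contains `U` or lies inside `L`. So this
  -- set, which contains `u` but not `v`, is comparable with the whole chain and belongs to it by
  -- maximality.
  have hmem : L ∪ X ∩ U ∈ K := by
    refine key _ (h_union _ (hKT hLK) _ (h_inter _ hX _ (hKT hUK))) fun C hC => ?_
    by_cases huC : u ∈ C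
    · have hvC : v ∈ C := (hcon C hC).1 huC
      have hUC : U ⊆ C := by
        rcases hK.total hUK hC with h | h
        · exact h
        · exact hUmin ⟨hC, huC, hvC⟩ h
      exact Or.inl (Set.union_subset (hLU.trans hUC) (Set.inter_subset_right.trans hUC))
    · have hvC : v ∉ C := fun h => huC ((hcon C hC).2 h)
      have hCL : C ⊆ L := by
        rcases hK.total hC hLK with h | h
        · exact h
        · exact hLmax ⟨hC, huC, hvC⟩ h
      exact Or.inr (hCL.trans Set.subset_union_left)
  have := (hcon _ hmem).1 (Or.inr ⟨hu, huU⟩)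
  rcases this with h | h
  · exact hvL h
  · exact hv h.1

/-- A graph whose edges are all cut by a lattice of sets of small cut size has few edges. -/
theorem dartCount_le_of_lattice {V : Type*} [Fintype V] (F : SimpleGraph V) (κ : ℕ)
    (T : Set (Set V)) (h_empty : ∅ ∈ T) (h_univ : Set.univ ∈ T)
    (h_inter : ∀ X ∈ T, ∀ Y ∈ T, X ∩ Y ∈ T) (h_union : ∀ X ∈ T, ∀ Y ∈ T, X ∪ Y ∈ T)
    (h_cut : ∀ X ∈ T, cutSize F X ≤ κ)
    (h_adj : ∀ u v, F.Adj u v → ∃ X ∈ T, (u ∈ X ∧ v ∉ X) ∨ (v ∈ X ∧ u ∉ X)) :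
    dartCount F ≤ 4 * Fintype.card V * (Nat.sqrt κ + 1) := by
  classical
  obtain ⟨K, hKT, hK, h0, h1, hsep⟩ :=
    exists_separating_chain T h_empty h_univ h_inter h_union
  have hC : ∀ v : V, ∃ C ∈ K, v ∈ C ∧ ∀ C' ∈ K, v ∈ C' → C ⊆ C' := by
    intro v
    obtain ⟨C, ⟨hCK, hvC⟩, hmin⟩ :=
      Set.Finite.exists_minimal (s := {C | C ∈ K ∧ v ∈ C}) (Set.toFinite _)
        ⟨Set.univ, h1, by simp⟩
    refine ⟨C, hCK, hvC, fun C' hC' hv => ?_⟩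
    rcases hK.total hCK hC' with h | h
    · exact h
    · exact hmin ⟨hC', hv⟩ h
  have hD : ∀ i : ℕ, ∃ D ∈ K, D.ncard ≤ i ∧ ∀ C ∈ K, C.ncard ≤ i → C ⊆ D := by
    intro i
    obtain ⟨D, ⟨hDK, hDi⟩, hmax⟩ :=
      Set.Finite.exists_maximal (s := {C | C ∈ K ∧ C.ncard ≤ i}) (Set.toFinite _)
        ⟨∅, h0, by simp⟩
    refine ⟨D, hDK, hDi, fun C hCK hCi => ?_⟩
    rcases hK.total hCK hDK with h | h
    · exact h
    · exact hmax ⟨hCK, hCi⟩ h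
  choose C hCK hCmem hCmin using hC
  choose D hDK hDcard hDmax using hD
  -- The position of `v` along the chain; end points of an edge of `F` have different positions.
  set p : V → ℕ := fun v => (C v).ncard with hp
  have hpn : ∀ v, p v ≤ Fintype.card V := fun v => by
    rw [← Nat.card_eq_fintype_card]; exact Set.ncard_le_card _
  have hstep : ∀ u v : V, ∀ E ∈ K, u ∈ E → v ∉ E → p u < p v := by
    intro u v E hE hu hv
    refine Set.ncard_lt_ncard ?_ (Set.toFinite _)
    have hv' : v ∉ C u := fun h => hv (hCmin u E hE hu h)
    rcases hK.total (hCK u) (hCK v) with h | h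
    · exact ⟨h, fun h' => hv' (h' (hCmem v))⟩
    · exact absurd (h (hCmem v)) hv'
  have hne : ∀ u v, F.Adj u v → p u < p v ∨ p v < p u := by
    intro u v huv
    obtain ⟨X, hX, hh⟩ := h_adj u v huv
    have : ∃ E ∈ K, (u ∈ E ∧ v ∉ E) ∨ (v ∈ E ∧ u ∉ E) := by
      rcases hh with ⟨a, b⟩ | ⟨a, b⟩
      · exact hsep X hX u a v b
      · obtain ⟨E, hE, h⟩ := hsep X hX v a u b
        exact ⟨E, hE, h.symm⟩
    obtain ⟨E, hE, ⟨a, b⟩ | ⟨a, b⟩⟩ := this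
    · exact Or.inl (hstep _ _ E hE a b)
    · exact Or.inr (hstep _ _ E hE a b)
  set n := Fintype.card V with hn
  -- This threshold between short and long edges balances the bounds `n * l` and `(n / l) * κ`.
  set l := Nat.sqrt κ + 1 with hl
  -- Short edges: at most `l` vertices have position in `(p u, p u + l]`.
  set S : Finset (V × V) := Finset.univ.biUnion fun u =>
    (D (p u + l) \ C u).toFinset.image fun v => (u, v) with hS
  -- Long edges: each jumps over a multiple of `l`, hence crosses one of these `n / l` chain
  -- members.
  set R : Finset (V × V) := (Finset.Icc 1 (n / l)).biUnion fun j =>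
    Finset.univ.filter fun q : V × V => q.1 ∈ D (j * l) ∧ q.2 ∉ D (j * l) ∧ F.Adj q.1 q.2 with hR
  have hScard : S.card ≤ n * l := by
    refine (Finset.card_biUnion_le_card_mul _ _ l fun u _ => ?_)
    refine Finset.card_image_le.trans ?_
    rw [← Set.ncard_eq_toFinset_card', Set.ncard_sdiff]
    · have := hDcard (p u + l)
      simp only [hp] at this ⊢
      omega
    · exact hDmax _ _ (hCK u) (Nat.le_add_right _ _)
  have hRcard : R.card ≤ n * l := by
    have h2 : R.card ≤ (Finset.Icc 1 (n / l)).card * κ :=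
      Finset.card_biUnion_le_card_mul _ _ κ fun j _ => by
        rw [← cutSize_eq_card]
        exact h_cut _ (hKT (hDK _))
    rw [Nat.card_Icc, Nat.add_sub_cancel] at h2
    have h3 : κ ≤ l * l := (Nat.lt_succ_sqrt κ).le
    calc R.card ≤ n / l * κ := h2
      _ ≤ n / l * (l * l) := Nat.mul_le_mul_left _ h3
      _ = n / l * l * l := by ring
      _ ≤ n * l := Nat.mul_le_mul_right _ (Nat.div_mul_le_self _ _)
  have hcover : ∀ u v, F.Adj u v → p u < p v → (u, v) ∈ S ∪ R := by
    intro u v huv hlt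
    rw [Finset.mem_union]
    by_cases hshort : p v ≤ p u + l
    · left
      simp only [hS, Finset.mem_biUnion, Finset.mem_univ, true_and, Finset.mem_image,
        Set.mem_toFinset]
      refine ⟨u, v, ⟨hDmax _ _ (hCK v) hshort (hCmem v), fun h => ?_⟩, rfl⟩
      have := Set.ncard_le_ncard (hCmin v _ (hCK u) h) (Set.toFinite _)
      simp only [hp] at hlt
      omega
    · right
      have hlpos : 0 < l := Nat.succ_pos _
      have hj1 : p u < (p u / l + 1) * l := by
        have := Nat.div_add_mod (p u) l; have := Nat.mod_lt (p u) hlpos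
        nlinarith
      have hj2 : (p u / l + 1) * l ≤ p u + l := by
        rw [Nat.add_mul, one_mul]
        exact Nat.add_le_add_right (Nat.div_mul_le_self _ _) _
      simp only [hR, Finset.mem_biUnion, Finset.mem_Icc, Finset.mem_filter, Finset.mem_univ,
        true_and]
      refine ⟨p u / l + 1, ⟨Nat.le_add_left 1 _, ?_⟩, hDmax _ _ (hCK u) hj1.le (hCmem u), fun h => ?_, huv⟩
      · rw [Nat.le_div_iff_mul_le hlpos]
        have := hpn v
        omega
      · have h4 := Set.ncard_le_ncard (hCmin v _ (hDK _) h) (Set.toFinite _)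
        have h5 := hDcard ((p u / l + 1) * l)
        have : p v ≤ (D ((p u / l + 1) * l)).ncard := h4
        omega
  have hall : (Finset.univ.filter fun q : V × V => F.Adj q.1 q.2) ⊆
      (S ∪ R) ∪ (S ∪ R).image Prod.swap := by
    rintro ⟨u, v⟩ hq
    have huv : F.Adj u v := by simpa using hq
    rcases hne u v huv with h | h
    · exact Finset.mem_union_left _ (hcover u v huv h)
    · exact Finset.mem_union_right _
        (Finset.mem_image.2 ⟨(v, u), hcover v u huv.symm h, rfl⟩)
  rw [dartCount_eq_card]
  have e1 := Finset.card_le_card hall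
  have e2 := Finset.card_union_le (S ∪ R) ((S ∪ R).image Prod.swap)
  have e3 := Finset.card_image_le (s := S ∪ R) (f := Prod.swap)
  have e4 := Finset.card_union_le S R
  have e5 : 4 * n * l = 4 * (n * l) := by ring
  omega

/-- If adding the graph `A` raises a submodular function from `lam - κ` to `lam` on all `s`-`t`
sets, then so does a subgraph of `A` with `O(n √κ)` edges. -/
theorem exists_sparse_augmentation {V : Type*} [Fintype V] (s t : V) (h : Set V → ℕ)
    (hsub : IsSubmodular h) (A : SimpleGraph V) (lam κ : ℕ)
    (hA : ∀ X : Set V, s ∈ X → t ∉ X → lam ≤ h X + cutSize A X)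
    (hκ : ∀ X : Set V, s ∈ X → t ∉ X → lam ≤ h X + κ) :
    ∃ F ≤ A, (∀ X : Set V, s ∈ X → t ∉ X → lam ≤ h X + cutSize F X) ∧
      dartCount F ≤ 4 * Fintype.card V * (Nat.sqrt κ + 1) := by
  classical
  obtain ⟨F, ⟨hFA, hF⟩, hmin⟩ :=
    Set.Finite.exists_minimal
      (s := {F : SimpleGraph V | F ≤ A ∧ ∀ X : Set V, s ∈ X → t ∉ X → lam ≤ h X + cutSize F X})
      (Set.toFinite _) ⟨A, le_rfl, hA⟩
  refine ⟨F, hFA, hF, ?_⟩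
  have hsub' := hsub.add (cutSize_submodular F)
  -- Tight sets, closed under intersection and union by uncrossing. Adding the two trivial sets
  -- costs nothing, as their cuts are empty.
  set T : Set (Set V) := {X | X = ∅ ∨ X = Set.univ ∨
    (s ∈ X ∧ t ∉ X ∧ h X + cutSize F X = lam)} with hT
  have hmod : ∀ X Y : Set V, (s ∈ X ∧ t ∉ X ∧ h X + cutSize F X = lam) →
      (s ∈ Y ∧ t ∉ Y ∧ h Y + cutSize F Y = lam) →
      (s ∈ X ∩ Y ∧ t ∉ X ∩ Y ∧ h (X ∩ Y) + cutSize F (X ∩ Y) = lam) ∧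
      (s ∈ X ∪ Y ∧ t ∉ X ∪ Y ∧ h (X ∪ Y) + cutSize F (X ∪ Y) = lam) := by
    rintro X Y ⟨x1, x2, x3⟩ ⟨y1, y2, y3⟩
    have i1 : s ∈ X ∩ Y := ⟨x1, y1⟩
    have i2 : t ∉ X ∩ Y := fun h => x2 h.1
    have u1 : s ∈ X ∪ Y := Or.inl x1
    have u2 : t ∉ X ∪ Y := fun h => h.elim x2 y2
    have a := hF _ i1 i2
    have b := hF _ u1 u2
    have c := hsub' X Y
    simp only at c
    exact ⟨⟨i1, i2, by omega⟩, ⟨u1, u2, by omega⟩⟩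
  refine dartCount_le_of_lattice F κ T (Or.inl rfl) (Or.inr (Or.inl rfl)) ?_ ?_ ?_ ?_
  · rintro X (rfl | rfl | hX) Y (rfl | rfl | hY)
    all_goals try simp [hT]
    · exact Or.inr (Or.inr hY)
    · exact Or.inr (Or.inr hX)
    · simpa using Or.inr (Or.inr (hmod X Y hX hY).1)
  · rintro X (rfl | rfl | hX) Y (rfl | rfl | hY)
    all_goals try simp [hT]
    · exact Or.inr (Or.inr hY)
    · exact Or.inr (Or.inr hX)
    · simpa using Or.inr (Or.inr (hmod X Y hX hY).2)
  · rintro X (rfl | rfl | ⟨x1, x2, x3⟩)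
    · simp [cutSize]
    · simp [cutSize]
    · have := hκ X x1 x2
      omega
  · intro u v huv
    -- An edge crossing no tight set could be deleted: tight cuts keep their size, and the other
    -- cuts have slack for the loss of one edge.
    by_contra! hcon
    have hlt : ¬ F ≤ F.deleteEdges {s(u, v)} := fun hle => by
      have := hle huv
      simp at this
    refine hlt (hmin ⟨(F.deleteEdges_le _).trans hFA, fun X hs ht => ?_⟩ (F.deleteEdges_le _))
    by_cases htight : h X + cutSize F X = lam
    · have hX : X ∈ T := Or.inr (Or.inr ⟨hs, ht, htight⟩)
      have hXs := hcon X hX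
      have : cutSize F X ≤ cutSize (F.deleteEdges {s(u, v)}) X := by
        refine Set.ncard_le_ncard ?_ (Set.toFinite _)
        rintro ⟨a, b⟩ ⟨ha, hb, hab⟩
        refine ⟨ha, hb, ?_⟩
        simp only [SimpleGraph.deleteEdges_adj, Set.mem_singleton_iff, Sym2.eq_iff]
        refine ⟨hab, ?_⟩
        rintro (⟨rfl, rfl⟩ | ⟨rfl, rfl⟩)
        · exact hb (hXs.1 ha)
        · exact hb (hXs.2 ha)
      have := hF X hs ht
      omega
    · have h1 := hF X hs ht
      have : cutSize F X ≤ cutSize (F.deleteEdges {s(u, v)}) X + 1 := by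
        have hle : {p : V × V | p.1 ∈ X ∧ p.2 ∉ X ∧ F.Adj p.1 p.2} ⊆
            {p : V × V | p.1 ∈ X ∧ p.2 ∉ X ∧ (F.deleteEdges {s(u, v)}).Adj p.1 p.2} ∪
              {if u ∈ X then (u, v) else (v, u)} := by
          rintro ⟨a, b⟩ ⟨ha, hb, hab⟩
          by_cases he : s(a, b) = s(u, v)
          · right
            rw [Sym2.eq_iff] at he
            rcases he with ⟨rfl, rfl⟩ | ⟨rfl, rfl⟩
            · simp_all
            · simp_all
          · left
            exact ⟨ha, hb, by simp [hab, he]⟩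
        refine (Set.ncard_le_ncard hle (Set.toFinite _)).trans ?_
        refine (Set.ncard_union_le _ _).trans ?_
        rw [Set.ncard_singleton]
        rfl
      omega

/-! ### Composing protocols and sending messages -/

namespace CommProtocol

/-- Run one protocol and continue with another that depends on its output. -/
def bind {X Y Z W : Type*} : CommProtocol X Y Z → (Z → CommProtocol X Y W) → CommProtocol X Y W
  | .output z, k => k z
  | .alice msg next, k => .alice msg fun b => (next b).bind k
  | .bob msg next, k => .bob msg fun b => (next b).bind k

theorem run_bind {X Y Z W : Type*} (P : CommProtocol X Y Z) (k : Z → CommProtocol X Y W)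
    (x : X) (y : Y) : (P.bind k).run x y = (k (P.run x y)).run x y := by
  induction P with
  | output z => rfl
  | alice msg next ih => exact ih _
  | bob msg next ih => exact ih _

theorem cost_bind_le {X Y Z W : Type*} (P : CommProtocol X Y Z) (k : Z → CommProtocol X Y W)
    (c : ℕ) (hc : ∀ z, (k z).cost ≤ c) : (P.bind k).cost ≤ P.cost + c := by
  induction P with
  | output z => simpa [bind, cost] using hc z
  | alice msg next ih =>
    have := ih false
    have := ih true
    simp only [bind, cost]
    omega
  | bob msg next ih =>
    have := ih false
    have := ih true
    simp only [bind, cost]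
    omega

/-- Alice can announce a number below `2 ^ b` with `b` bits. -/
theorem exists_alice_send_nat {X Y Z : Type*} (b : ℕ) : ∀ (msg : X → ℕ) (_ : ∀ x, msg x < 2 ^ b)
    (next : ℕ → CommProtocol X Y Z) (c : ℕ) (_ : ∀ m, (next m).cost ≤ c),
    ∃ P : CommProtocol X Y Z, P.cost ≤ b + c ∧ ∀ x y, P.run x y = (next (msg x)).run x y := by
  induction b with
  | zero =>
    intro msg hmsg next c hc
    refine ⟨next 0, by simpa using hc 0, fun x y => ?_⟩
    have := hmsg x
    rw [show msg x = 0 by omega]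
  | succ b ih =>
    intro msg hmsg next c hc
    have hlt : ∀ x, msg x / 2 < 2 ^ b := fun x => by
      have := hmsg x
      omega
    obtain ⟨P0, hP0, hr0⟩ := ih (fun x => msg x / 2) hlt (fun m => next (2 * m)) c fun m => hc _
    obtain ⟨P1, hP1, hr1⟩ := ih (fun x => msg x / 2) hlt (fun m => next (2 * m + 1)) c
      fun m => hc _
    refine ⟨.alice (fun x => decide (msg x % 2 = 1)) (fun i => bif i then P1 else P0), ?_, ?_⟩
    · simp only [cost, cond_false, cond_true]
      omega
    · intro x y
      rcases Nat.mod_two_eq_zero_or_one (msg x) with h | h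
      · simp only [run, h, zero_ne_one, decide_false, cond_false, hr0]
        rw [show 2 * (msg x / 2) = msg x by omega]
      · simp only [run, h, decide_true, cond_true, hr1]
        rw [show 2 * (msg x / 2) + 1 = msg x by omega]

/-- Exchange the roles of the players. -/
def swap {X Y Z : Type*} : CommProtocol X Y Z → CommProtocol Y X Z
  | .output z => .output z
  | .alice msg next => .bob msg fun b => (next b).swap
  | .bob msg next => .alice msg fun b => (next b).swap

theorem run_swap {X Y Z : Type*} (P : CommProtocol X Y Z) (x : X) (y : Y) :
    P.swap.run y x = P.run x y := by
  induction P with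
  | output z => rfl
  | alice msg next ih => exact ih _
  | bob msg next ih => exact ih _

theorem cost_swap {X Y Z : Type*} (P : CommProtocol X Y Z) : P.swap.cost = P.cost := by
  induction P with
  | output z => rfl
  | alice msg next ih => simp only [swap, cost, ih]
  | bob msg next ih => simp only [swap, cost, ih]

/-- Alice can announce an element of a type of size at most `2 ^ b` with `b` bits. -/
theorem exists_alice_send {X Y Z M : Type*} [Fintype M] [Nonempty M] (b : ℕ)
    (hM : Fintype.card M ≤ 2 ^ b)
    (msg : X → M) (next : M → CommProtocol X Y Z) (c : ℕ) (hc : ∀ m, (next m).cost ≤ c) :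
    ∃ P : CommProtocol X Y Z, P.cost ≤ b + c ∧ ∀ x y, P.run x y = (next (msg x)).run x y := by
  classical
  obtain ⟨m0⟩ := ‹Nonempty M›
  let e := Fintype.equivFin M
  obtain ⟨P, h1, h2⟩ := exists_alice_send_nat b (fun x => (e (msg x) : ℕ))
    (fun x => (e (msg x)).2.trans_le hM)
    (fun i => if h : i < Fintype.card M then next (e.symm ⟨i, h⟩) else next m0) c
    (fun i => by split_ifs <;> exact hc _)
  refine ⟨P, h1, fun x y => ?_⟩
  rw [h2]
  simp

/-- Bob can announce an element of a type of size at most `2 ^ b` with `b` bits. -/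
theorem exists_bob_send {X Y Z M : Type*} [Fintype M] [Nonempty M] (b : ℕ)
    (hM : Fintype.card M ≤ 2 ^ b)
    (msg : Y → M) (next : M → CommProtocol X Y Z) (c : ℕ) (hc : ∀ m, (next m).cost ≤ c) :
    ∃ P : CommProtocol X Y Z, P.cost ≤ b + c ∧ ∀ x y, P.run x y = (next (msg y)).run x y := by
  obtain ⟨P, h1, h2⟩ := exists_alice_send b hM msg (fun m => (next m).swap) c
    fun m => by rw [cost_swap]; exact hc m
  exact ⟨P.swap, by rwa [cost_swap], fun x y => by rw [run_swap, h2, run_swap]⟩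

end CommProtocol

/-! ### Expander decompositions and submodular cut sketches -/

theorem dartCount_bot {V : Type*} : dartCount (⊥ : SimpleGraph V) = 0 := by
  simp [dartCount]

section Clusters

variable {V : Type*} [Fintype V]

/-- The edges of `E` whose end points have different labels. -/
def interGraph {V : Type*} (E : SimpleGraph V) (c : V → V) : SimpleGraph V where
  Adj u v := E.Adj u v ∧ c u ≠ c v
  symm := ⟨fun _ _ h => ⟨h.1.symm, h.2.symm⟩⟩
  loopless := ⟨fun _ h => h.2 rfl⟩

open Classical in
/-- The sum of the degrees of the vertices of `X` within the subgraph induced by the label `j`. -/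
noncomputable def clusterVol (E : SimpleGraph V) (c : V → V) (j : V) (X : Set V) : ℕ :=
  (Finset.univ.filter fun p : V × V => p.1 ∈ X ∧ E.Adj p.1 p.2 ∧ c p.1 = j ∧ c p.2 = j).card

open Classical in
/-- The size of the cut `X` within the subgraph induced by the label `j`. -/
noncomputable def clusterCut (E : SimpleGraph V) (c : V → V) (j : V) (X : Set V) : ℕ :=
  (Finset.univ.filter fun p : V × V =>
    p.1 ∈ X ∧ p.2 ∉ X ∧ E.Adj p.1 p.2 ∧ c p.1 = j ∧ c p.2 = j).card

theorem clusterCut_compl (E : SimpleGraph V) (c : V → V) (j : V) (X : Set V) :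
    clusterCut E c j Xᶜ = clusterCut E c j X := by
  classical
  refine Finset.card_bij' (fun p _ => p.swap) (fun p _ => p.swap) ?_ ?_ ?_ ?_
  all_goals simp +contextual [E.adj_comm]

theorem clusterCut_le_clusterVol (E : SimpleGraph V) (c : V → V) (j : V) (X : Set V) :
    clusterCut E c j X ≤ clusterVol E c j X := by
  classical
  refine Finset.card_le_card fun p => ?_
  simp +contextual

/-- The smaller part has at most half the total, so its logarithm drops by at least one, which saves
`y`. The slack `a ≤ y`, `d ≤ z` accommodates the volume lost to cut edges. -/
theorem mul_log_superadditive {a d y z : ℕ} (ha : a ≤ y) (hd : d ≤ z) (hyz : y ≤ z) :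
    a * Nat.log 2 a + d * Nat.log 2 d + y ≤ (y + z) * Nat.log 2 (y + z) := by
  have hd' : d * Nat.log 2 d ≤ z * Nat.log 2 (y + z) :=
    Nat.mul_le_mul hd (Nat.log_mono_right (by omega))
  rcases Nat.eq_zero_or_pos y with rfl | hy
  · obtain rfl : a = 0 := by omega
    simpa using hd'
  · have h1 : Nat.log 2 a + 1 ≤ Nat.log 2 (y + z) := by
      have h2 : Nat.log 2 (y * 2) = Nat.log 2 y + 1 := Nat.log_mul_base (by norm_num) hy.ne'
      have h3 : Nat.log 2 (y * 2) ≤ Nat.log 2 (y + z) := Nat.log_mono_right (by omega)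
      have h4 : Nat.log 2 a ≤ Nat.log 2 y := Nat.log_mono_right ha
      omega
    have h5 : a * Nat.log 2 a + y ≤ y * Nat.log 2 (y + z) :=
      calc a * Nat.log 2 a + y ≤ y * Nat.log 2 a + y :=
            Nat.add_le_add_right (Nat.mul_le_mul_right _ ha) _
        _ = y * (Nat.log 2 a + 1) := by ring
        _ ≤ _ := Nat.mul_le_mul_left _ h1
    rw [Nat.add_mul]
    omega

/-- The quantity minimized by an expander decomposition. -/
noncomputable def clusterPotential (L : ℕ) (E : SimpleGraph V) (c : V → V) : ℕ :=
  2 * L * dartCount (interGraph E c) +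
    ∑ j, clusterVol E c j Set.univ * Nat.log 2 (clusterVol E c j Set.univ)

/-- Moving `X` within cluster `j` to an unused label raises the first term of the potential by `4 *
L` times the cut and lowers the entropy term by at least the volume of the smaller side; minimality
compares the two. If no label is unused, clusters are singletons and have no volume. -/
theorem clusterVol_le_of_minimal (L : ℕ) (E : SimpleGraph V) (c : V → V)
    (hmin : ∀ c', clusterPotential L E c ≤ clusterPotential L E c') (j : V) (X : Set V)
    (hX : clusterVol E c j X ≤ clusterVol E c j Xᶜ) :
    clusterVol E c j X ≤ 4 * L * clusterCut E c j X := by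
  classical
  by_cases hsurj : Function.Surjective c
  · have hinj : Function.Injective c := Finite.injective_iff_surjective.2 hsurj
    have : clusterVol E c j X = 0 := by
      rw [clusterVol, Finset.card_eq_zero, Finset.filter_eq_empty_iff]
      rintro ⟨u, v⟩ - ⟨-, h, h1, h2⟩
      exact h.ne (hinj (h1.trans h2.symm))
    omega
  rw [Function.Surjective] at hsurj
  push Not at hsurj
  obtain ⟨w, hw⟩ := hsurj
  by_cases hwj : w = j
  · have : clusterVol E c j X = 0 := by
      rw [clusterVol, Finset.card_eq_zero, Finset.filter_eq_empty_iff]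
      rintro ⟨u, v⟩ - ⟨-, h, h1, h2⟩
      exact hw u (h1.trans hwj.symm)
    omega
  set c' : V → V := fun u => if c u = j ∧ u ∈ X then w else c u with hc'
  have hcw : ∀ u, c' u = w ↔ c u = j ∧ u ∈ X := by
    intro u
    by_cases h : c u = j ∧ u ∈ X <;> simp [hc', h, hw]
  have hcj : ∀ u, c' u = j ↔ c u = j ∧ u ∉ X := by
    intro u
    by_cases h1 : c u = j <;> by_cases h2 : u ∈ X <;> simp [hc', h1, h2, hwj]
  have hci : ∀ i, i ≠ w → i ≠ j → ∀ u, c' u = i ↔ c u = i := by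
    intro i hiw hij u
    by_cases h1 : c u = j <;> by_cases h2 : u ∈ X <;> simp [hc', h1, h2, hiw.symm, hij.symm]
  set a := clusterVol E c' w Set.univ with ha
  set d := clusterVol E c' j Set.univ with hd
  set e := clusterCut E c j X with he
  have hvi : ∀ i, i ≠ w → i ≠ j → clusterVol E c' i Set.univ = clusterVol E c i Set.univ := by
    intro i hiw hij
    unfold clusterVol
    congr 1
    ext p
    simp [hci i hiw hij]
  have hvw : clusterVol E c w Set.univ = 0 := by
    simp [clusterVol, hw]
  have hy : clusterVol E c j X = a + e := by
    simp only [ha, he, clusterVol, clusterCut, hcw, Finset.card_filter, ← Finset.sum_add_distrib]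
    refine Finset.sum_congr rfl fun p _ => ?_
    by_cases h1 : p.1 ∈ X <;> by_cases h2 : p.2 ∈ X <;> simp [h1, h2]
  have hz : clusterVol E c j Xᶜ = d + e := by
    rw [he, ← clusterCut_compl]
    simp only [hd, clusterVol, clusterCut, hcj, Finset.card_filter, ← Finset.sum_add_distrib]
    refine Finset.sum_congr rfl fun p _ => ?_
    by_cases h1 : p.1 ∈ X <;> by_cases h2 : p.2 ∈ X <;> simp [h1, h2]
  have hyz : clusterVol E c j Set.univ = clusterVol E c j X + clusterVol E c j Xᶜ := by
    simp only [clusterVol, Finset.card_filter, ← Finset.sum_add_distrib]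
    refine Finset.sum_congr rfl fun p _ => ?_
    by_cases h1 : p.1 ∈ X <;> simp [h1]
  have hI : dartCount (interGraph E c') = dartCount (interGraph E c) + 2 * e := by
    have : 2 * e = clusterCut E c j X + clusterCut E c j Xᶜ := by
      rw [clusterCut_compl]; omega
    rw [this]
    simp only [dartCount_eq_card, interGraph, clusterCut, Finset.card_filter,
      ← Finset.sum_add_distrib]
    refine Finset.sum_congr rfl fun p _ => ?_
    have k1 := hw p.1
    have k2 := hw p.2

    have k4 : j = c p.2 ↔ c p.2 = j := eq_comm
    by_cases h3 : c p.1 = j <;> by_cases h4 : c p.2 = j <;>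
      by_cases h1 : p.1 ∈ X <;> by_cases h2 : p.2 ∈ X <;>
      simp [hc', h1, h2, h3, h4, k4, k1, k2.symm, hwj, Ne.symm hwj]
  have hsum := hmin c'
  have split : ∀ g : V → ℕ, ∑ i, g i =
      g w + (g j + ∑ i ∈ (Finset.univ.erase w).erase j, g i) := fun g => by
    rw [Finset.add_sum_erase _ g (Finset.mem_erase.2 ⟨Ne.symm hwj, Finset.mem_univ _⟩),
      Finset.add_sum_erase _ g (Finset.mem_univ _)]
  have hrest : ∑ i ∈ (Finset.univ.erase w).erase j,
      clusterVol E c' i Set.univ * Nat.log 2 (clusterVol E c' i Set.univ) =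
      ∑ i ∈ (Finset.univ.erase w).erase j,
      clusterVol E c i Set.univ * Nat.log 2 (clusterVol E c i Set.univ) := by
    refine Finset.sum_congr rfl fun i hi => ?_
    simp only [Finset.mem_erase] at hi
    rw [hvi i hi.2.1 hi.1]
  simp only [clusterPotential] at hsum
  rw [split, split (fun i => clusterVol E c' i Set.univ * _), hrest, hvw, hI, ← ha, ← hd, hyz]
    at hsum
  have hnum := mul_log_superadditive (a := a) (d := d) (y := clusterVol E c j X)
    (z := clusterVol E c j Xᶜ) (by omega) (by omega) hX
  have e1 : 2 * L * (dartCount (interGraph E c) + 2 * e) =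
    2 * L * dartCount (interGraph E c) + 4 * L * e := by ring
  omega

/-- Expander decomposition: the vertices can be labelled so that at most half of the edges join
different labels and each label induces an expander. -/
theorem exists_expander_decomposition [Nonempty V] (L : ℕ) (hL : 0 < L) (E : SimpleGraph V)
    (hE : dartCount E < 2 ^ L) :
    ∃ c : V → V, 2 * dartCount (interGraph E c) ≤ dartCount E ∧
      ∀ j X, min (clusterVol E c j X) (clusterVol E c j Xᶜ) ≤ 4 * L * clusterCut E c j X := by
  classical
  obtain ⟨c, hmin⟩ := Finite.exists_min (clusterPotential L E)
  refine ⟨c, ?_, fun j X => ?_⟩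
  · obtain ⟨v0⟩ := ‹Nonempty V›
    -- Comparison with the single-cluster labelling, whose potential is at most `dartCount E * L`.
    have h := hmin fun _ => v0
    have h1 : clusterPotential L E (fun _ => v0) = dartCount E * Nat.log 2 (dartCount E) := by
      have hI : interGraph E (fun _ => v0) = ⊥ := by
        ext u v
        simp [interGraph]
      have hv : clusterVol E (fun _ => v0) v0 Set.univ = dartCount E := by
        simp [clusterVol, dartCount_eq_card]
      rw [clusterPotential, hI, dartCount_bot, mul_zero, zero_add,
        Finset.sum_eq_single v0, hv]
      · intro b _ hb
        simp [clusterVol, hb.symm]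
      · simp
    have h2 : dartCount E * Nat.log 2 (dartCount E) ≤ dartCount E * L := by
      rcases Nat.eq_zero_or_pos (dartCount E) with h0 | h0
      · simp [h0]
      · exact Nat.mul_le_mul_left _ (Nat.log_lt_of_lt_pow h0.ne' hE).le
    have h3 : 2 * L * dartCount (interGraph E c) ≤ dartCount E * L := by
      rw [h1, clusterPotential] at h
      omega
    refine Nat.le_of_mul_le_mul_left (c := L) ?_ hL
    calc L * (2 * dartCount (interGraph E c)) = 2 * L * dartCount (interGraph E c) := by ring
      _ ≤ dartCount E * L := h3
      _ = L * dartCount E := by ring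
  · rcases le_total (clusterVol E c j X) (clusterVol E c j Xᶜ) with h | h
    · exact (min_le_left _ _).trans (clusterVol_le_of_minimal L E c hmin j X h)
    · rw [← clusterCut_compl]
      refine (min_le_right _ _).trans (clusterVol_le_of_minimal L E c hmin j Xᶜ ?_)
      rwa [compl_compl]

theorem cutSize_eq_inter_add (E : SimpleGraph V) (c : V → V) (X : Set V) :
    cutSize E X = cutSize (interGraph E c) X + ∑ j, clusterCut E c j X := by
  classical
  simp only [cutSize_eq_card, clusterCut, Finset.card_filter]
  rw [Finset.sum_comm, ← Finset.sum_add_distrib]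
  refine Finset.sum_congr rfl fun p _ => ?_
  by_cases h : c p.1 = c p.2
  · have : ∀ j, (c p.1 = j ∧ c p.2 = j) ↔ j = c p.2 := fun j =>
      ⟨fun h => h.2.symm, fun hj => ⟨h.trans hj.symm, hj.symm⟩⟩
    simp only [interGraph, h, ne_eq, not_true_eq_false, and_false, if_false, zero_add]
    by_cases h2 : p.1 ∈ X ∧ p.2 ∉ X ∧ E.Adj p.1 p.2
    · simp [h2]
    · rw [if_neg h2, Finset.sum_eq_zero]
      intro j _
      rw [if_neg]
      tauto
  · have : ∀ j, ¬ (c p.1 = j ∧ c p.2 = j) := fun j hj => h (hj.1.trans hj.2.symm)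
    simp [interGraph, this, h]

/-- A labelling of the vertices together with a weight at each vertex. -/
abbrev ClusterSketch (V : Type*) [Fintype V] := V → V × Fin (Fintype.card V)

open Classical in
/-- The weight of the vertices of `X` with label `j`. -/
noncomputable def ClusterSketch.weight (ρ : ClusterSketch V) (j : V) (X : Set V) : ℕ :=
  ∑ u, if u ∈ X ∧ (ρ u).1 = j then ((ρ u).2 : ℕ) else 0

/-- The sum over all labels of the smaller of the weights inside and outside `X`. -/
noncomputable def ClusterSketch.eval (ρ : ClusterSketch V) (X : Set V) : ℕ :=
  ∑ j, min (ρ.weight j X) (ρ.weight j Xᶜ)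

/-- For each label the summand is the concave function `x ↦ min x (W - x)` of a modular weight,
where `W` is the label's total weight. -/
theorem ClusterSketch.eval_submodular (ρ : ClusterSketch V) : IsSubmodular ρ.eval := by
  classical
  refine IsSubmodular.sum _ fun j _ X Y => ?_
  have hadd : ∀ X Y, ρ.weight j (X ∩ Y) + ρ.weight j (X ∪ Y) = ρ.weight j X + ρ.weight j Y := by
    intro X Y
    simp only [weight, ← Finset.sum_add_distrib]
    refine Finset.sum_congr rfl fun u _ => ?_
    by_cases h1 : u ∈ X <;> by_cases h2 : u ∈ Y <;> simp [h1, h2]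
  have hmono : ∀ X Y, X ⊆ Y → ρ.weight j X ≤ ρ.weight j Y := by
    intro X Y hXY
    refine Finset.sum_le_sum fun u _ => ?_
    by_cases h1 : u ∈ X
    · simp [h1, hXY h1]
    · simp [h1]
  have a1 := hadd X Y
  have a2 := hadd Xᶜ Yᶜ
  rw [← Set.compl_union, ← Set.compl_inter] at a2
  have b1 := hmono _ _ (Set.inter_subset_left (s := X) (t := Y))
  have b2 := hmono _ _ (Set.inter_subset_right (s := X) (t := Y))
  have b3 := hmono _ _ (Set.compl_subset_compl.2 (Set.subset_union_left (s := X) (t := Y)))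
  have b4 := hmono _ _ (Set.compl_subset_compl.2 (Set.subset_union_right (s := X) (t := Y)))
  omega

theorem exists_clusterSketch (E : SimpleGraph V) (c : V → V) :
    ∃ ρ : ClusterSketch V, ∀ j X, ρ.weight j X = clusterVol E c j X := by
  classical
  have hlt : ∀ u, (Finset.univ.filter fun v => E.Adj u v ∧ c u = c v).card < Fintype.card V := by
    intro u
    rw [← Finset.card_univ]
    refine Finset.card_lt_card ⟨Finset.filter_subset _ _, fun h => ?_⟩
    simpa using h (Finset.mem_univ u)
  refine ⟨fun u => (c u, ⟨_, hlt u⟩), fun j X => ?_⟩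
  simp only [ClusterSketch.weight, clusterVol, Finset.card_filter, Fintype.sum_prod_type]
  refine Finset.sum_congr rfl fun u _ => ?_
  by_cases h1 : u ∈ X <;> by_cases h2 : c u = j
  · simp only [h1, h2, true_and, and_self, if_true]
    refine Finset.sum_congr rfl fun v _ => ?_
    simp only [eq_comm]
  all_goals simp [h1, h2]

/-- The sum of the values of a family of cluster sketches. -/
noncomputable def sketchEval {L : ℕ} (σ : Fin L → ClusterSketch V) (X : Set V) : ℕ :=
  ∑ i, (σ i).eval X

theorem sketchEval_submodular {L : ℕ} (σ : Fin L → ClusterSketch V) :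
    IsSubmodular (sketchEval σ) :=
  IsSubmodular.sum _ fun i _ => (σ i).eval_submodular

/-- Logarithmically many cluster sketches approximate all cuts of a graph within a logarithmic
factor. -/
theorem exists_sketch [Nonempty V] (M : ℕ) (hM : 0 < M) : ∀ (L : ℕ), L ≤ M →
    ∀ E : SimpleGraph V, dartCount E < 2 ^ L →
    ∃ σ : Fin L → ClusterSketch V, ∀ X,
      cutSize E X ≤ sketchEval σ X ∧ sketchEval σ X ≤ 4 * M * cutSize E X := by
  intro L
  induction L with
  | zero =>
    intro _ E hE
    refine ⟨Fin.elim0, fun X => ⟨?_, by simp [sketchEval]⟩⟩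
    have : cutSize E X ≤ dartCount E :=
      Set.ncard_le_ncard (fun p hp => hp.2.2) (Set.toFinite _)
    omega
  | succ L ih =>
    intro hLM E hE
    obtain ⟨c, hhalf, hexp⟩ := exists_expander_decomposition M hM E
      (hE.trans_le (Nat.pow_le_pow_right (by norm_num) hLM))
    -- Only the edges between clusters, at most half of them, are left to the remaining levels. Each
    -- edge is charged at one level, so the approximation factor does not accumulate.
    obtain ⟨σ, hσ⟩ := ih (by omega) (interGraph E c) (by omega)
    obtain ⟨ρ, hρ⟩ := exists_clusterSketch E c
    refine ⟨Fin.cons ρ σ, fun X => ?_⟩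
    have hev : sketchEval (Fin.cons ρ σ : Fin (L + 1) → ClusterSketch V) X =
        ρ.eval X + sketchEval σ X := by
      simp [sketchEval, Fin.sum_univ_succ]
    have h1 : ∑ j, clusterCut E c j X ≤ ρ.eval X := by
      refine Finset.sum_le_sum fun j _ => ?_
      rw [hρ, hρ]
      refine le_min (clusterCut_le_clusterVol _ _ _ _) ?_
      rw [← clusterCut_compl]
      exact clusterCut_le_clusterVol _ _ _ _
    have h2 : ρ.eval X ≤ 4 * M * ∑ j, clusterCut E c j X := by
      rw [Finset.mul_sum]
      refine Finset.sum_le_sum fun j _ => ?_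
      rw [hρ, hρ]
      exact hexp j X
    obtain ⟨h3, h4⟩ := hσ X
    rw [hev, cutSize_eq_inter_add E c X, Nat.mul_add]
    omega

end Clusters

/-! ### Counting the possible messages -/

section EdgeLists

variable {V : Type*} [Fintype V]

/-- The graph with a given list of edges. -/
def graphOfList {M : ℕ} (g : Fin M → V × V) : SimpleGraph V :=
  SimpleGraph.fromRel fun u v => ∃ i, g i = (u, v)

theorem exists_graphOfList_eq [Nonempty V] {M : ℕ} (F : SimpleGraph V) (hF : dartCount F ≤ M) :
    ∃ g : Fin M → V × V, graphOfList g = F := by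
  classical
  obtain ⟨v0⟩ := ‹Nonempty V›
  rw [dartCount_eq_card] at hF
  set D := Finset.univ.filter fun p : V × V => F.Adj p.1 p.2 with hD
  -- Unused slots hold a diagonal pair, which `SimpleGraph.fromRel` discards.
  refine ⟨fun i => if h : (i : ℕ) < D.card then (D.equivFin.symm ⟨i, h⟩ : V × V) else (v0, v0), ?_⟩
  have key : ∀ u v, u ≠ v → ((∃ i : Fin M, (if h : (i : ℕ) < D.card then
      (D.equivFin.symm ⟨i, h⟩ : V × V) else (v0, v0)) = (u, v)) ↔ F.Adj u v) := by
    intro u v huv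
    constructor
    · rintro ⟨i, hi⟩
      split_ifs at hi with h
      · have := (D.equivFin.symm ⟨i, h⟩).2
        rw [hi] at this
        simpa [hD] using this
      · simp only [Prod.mk.injEq] at hi
        exact absurd (hi.1.symm.trans hi.2) huv
    · intro h
      have hmem : (u, v) ∈ D := by simpa [hD] using h
      refine ⟨⟨D.equivFin ⟨_, hmem⟩, (D.equivFin ⟨_, hmem⟩).2.trans_le hF⟩, ?_⟩
      rw [dif_pos (D.equivFin ⟨_, hmem⟩).2]
      simp
  ext u v
  simp only [graphOfList, SimpleGraph.fromRel_adj]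
  constructor
  · rintro ⟨huv, h | h⟩
    · exact (key u v huv).1 h
    · exact ((key v u huv.symm).1 h).symm
  · intro h
    exact ⟨h.ne, Or.inl ((key u v h.ne).2 h)⟩

theorem card_graph_code_le (M b : ℕ) (hb : Fintype.card V ≤ 2 ^ b) :
    Fintype.card (Fin M → V × V) ≤ 2 ^ (2 * b * M) := by
  classical
  rw [Fintype.card_fun, Fintype.card_prod, Fintype.card_fin, pow_mul]
  refine Nat.pow_le_pow_left ?_ _
  calc Fintype.card V * Fintype.card V ≤ 2 ^ b * 2 ^ b := Nat.mul_le_mul hb hb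
    _ = 2 ^ (2 * b) := by ring

theorem card_sketch_le [DecidableEq V] (L b : ℕ) (hb : Fintype.card V ≤ 2 ^ b) :
    Fintype.card (Fin L → ClusterSketch V) ≤ 2 ^ (2 * b * Fintype.card V * L) := by
  rw [Fintype.card_fun, Fintype.card_fun, Fintype.card_prod, Fintype.card_fin, Fintype.card_fin,
    pow_mul, pow_mul]
  refine Nat.pow_le_pow_left (Nat.pow_le_pow_left ?_ _) _
  calc Fintype.card V * Fintype.card V ≤ 2 ^ b * 2 ^ b := Nat.mul_le_mul hb hb
    _ = 2 ^ (2 * b) := by ring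

theorem dartCount_lt_two_pow (E : SimpleGraph V) (b : ℕ) (hb : Fintype.card V < 2 ^ b) :
    dartCount E < 2 ^ (2 * b) := by
  classical
  have h1 : dartCount E ≤ Fintype.card V * Fintype.card V := by
    rw [dartCount_eq_card, ← Fintype.card_prod, ← Finset.card_univ]
    exact Finset.card_filter_le _ _
  calc dartCount E ≤ Fintype.card V * Fintype.card V := h1
    _ < 2 ^ b * 2 ^ b := Nat.mul_lt_mul'' hb hb
    _ = 2 ^ (2 * b) := by ring

end EdgeLists

/-! ### The improvement round and its iteration -/

/-- Every cut separating `s` from `t` has size at least `f - k` in `G`. -/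
def CutsAtLeast {V : Type*} (s t : V) (G : SimpleGraph V) (f k : ℕ) : Prop :=
  ∀ X : Set V, s ∈ X → t ∉ X → f ≤ cutSize G X + k

/-- With `c` bits of communication, a known subgraph whose `s`-`t` cuts have size at least `f - k`
can be improved to one whose `s`-`t` cuts have size at least `f - k'`. -/
def CanImprove {V : Type*} (s t : V) (f c k k' : ℕ) : Prop :=
  ∀ H : SimpleGraph V, CutsAtLeast s t H f k →
    ∃ P : CommProtocol (SimpleGraph V) (SimpleGraph V) (SimpleGraph V), P.cost ≤ c ∧
      ∀ GA GB : SimpleGraph V, H ≤ GA ⊔ GB → CutsAtLeast s t (GA ⊔ GB) f 0 →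
        P.run GA GB ≤ GA ⊔ GB ∧ CutsAtLeast s t (P.run GA GB) f k'

theorem CanImprove.refl {V : Type*} (s t : V) (f k : ℕ) : CanImprove s t f 0 k k :=
  fun H hH => ⟨.output H, le_rfl, fun _ _ h _ => ⟨h, hH⟩⟩

theorem CanImprove.trans {V : Type*} {s t : V} {f c c' k k' k'' : ℕ}
    (h : CanImprove s t f c k k') (h' : CanImprove s t f c' k' k'') :
    CanImprove s t f (c + c') k k'' := by
  classical
  intro H hH
  obtain ⟨P, hP, hrun⟩ := h H hH
  choose Q hQ hQrun using h'
  -- The second branch is reached only on inputs violating the promise; it merely has to be cheap.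
  refine ⟨P.bind fun H' => if hH' : CutsAtLeast s t H' f k' then Q H' hH' else .output H', ?_, ?_⟩
  · refine (P.cost_bind_le _ c' fun H' => ?_).trans (Nat.add_le_add_right hP _)
    split_ifs with hH'
    · exact hQ _ _
    · exact Nat.zero_le _
  · intro GA GB hle hG
    obtain ⟨h1, h2⟩ := hrun GA GB hle hG
    rw [CommProtocol.run_bind, dif_pos h2]
    exact hQrun _ _ GA GB h1 hG

/-- The cost of one improvement step. -/
def stepCost (n b k : ℕ) : ℕ :=
  2 * b * n * (2 * b) + (2 * b * (4 * n * (Nat.sqrt k + 1)) + (2 * b * (4 * n * (Nat.sqrt k + 1)) + 0))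

/-- The factor `8 * b` is the sketch distortion; another factor two is lost because the edge sets
sent by Alice and Bob may overlap. -/
theorem canImprove_step {V : Type*} [Fintype V] (s t : V) (f k b : ℕ) (hb0 : 0 < b)
    (hb : Fintype.card V < 2 ^ b) :
    CanImprove s t f (stepCost (Fintype.card V) b k) k (k * (16 * b - 1) / (16 * b)) := by
  classical
  intro H hH
  have : Nonempty V := ⟨s⟩
  set M := 4 * Fintype.card V * (Nat.sqrt k + 1) with hM
  -- The ceiling of `k / (8 * b)`, the gain available when the two sent edge sets are counted
  -- separately.
  set y := (k + (8 * b - 1)) / (8 * b) with hy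
  have hyk : y ≤ k := by
    rw [hy]
    rcases Nat.eq_zero_or_pos k with rfl | hk
    · rw [Nat.div_eq_of_lt (by omega)]
    · refine Nat.div_le_of_le_mul ?_
      obtain ⟨c, hc⟩ : ∃ c, 8 * b = c + 1 := ⟨8 * b - 1, by omega⟩
      rw [hc, Nat.add_sub_cancel]
      nlinarith
  have hyb : ∀ x, k ≤ 8 * b * x → y ≤ x := by
    intro x hx
    rw [hy, ← Nat.lt_succ_iff, Nat.div_lt_iff_lt_mul (by omega)]
    have : x.succ * (8 * b) = 8 * b * x + 8 * b := by rw [Nat.succ_eq_add_one]; ring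
    omega
  have hyb' : k ≤ 8 * b * y := by
    have h1 := Nat.div_add_mod (k + (8 * b - 1)) (8 * b)
    have h2 := Nat.mod_lt (k + (8 * b - 1)) (show 0 < 8 * b by omega)
    rw [hy]
    omega
  have hS : ∀ B : SimpleGraph V, ∃ σ : Fin (2 * b) → ClusterSketch V, ∀ X,
      cutSize B X ≤ sketchEval σ X ∧ sketchEval σ X ≤ 8 * b * cutSize B X := by
    intro B
    obtain ⟨σ, hσ⟩ := exists_sketch (2 * b) (by omega) (2 * b) le_rfl B
      (dartCount_lt_two_pow B b hb)
    refine ⟨σ, fun X => ⟨(hσ X).1, (hσ X).2.trans_eq (by ring)⟩⟩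
  choose sk hsk using hS
  have hA : ∀ (A : SimpleGraph V) (σ : Fin (2 * b) → ClusterSketch V), ∃ g : Fin M → V × V,
      (∀ X : Set V, s ∈ X → t ∉ X → f ≤ cutSize H X + sketchEval σ X + cutSize A X) →
      graphOfList g ≤ A ∧ ∀ X : Set V, s ∈ X → t ∉ X →
        f ≤ cutSize H X + sketchEval σ X + cutSize (graphOfList g) X := by
    intro A σ
    by_cases h : ∀ X : Set V, s ∈ X → t ∉ X → f ≤ cutSize H X + sketchEval σ X + cutSize A X
    · obtain ⟨F, hFA, hF, hcard⟩ := exists_sparse_augmentation s t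
        (fun X => cutSize H X + sketchEval σ X)
        ((cutSize_submodular H).add (sketchEval_submodular σ)) A f k h
        fun X h1 h2 => by have := hH X h1 h2; omega
      obtain ⟨g, rfl⟩ := exists_graphOfList_eq F hcard
      exact ⟨g, fun _ => ⟨hFA, hF⟩⟩
    · exact ⟨fun _ => (s, s), fun h' => absurd h' h⟩
  choose ca hca using hA
  -- The target is `f - k + y`, written without subtraction. The gap Bob must fill is at most `y ≤
  -- k`, so his list obeys the same length bound as Alice's.
  have hB : ∀ (B F : SimpleGraph V), ∃ g : Fin M → V × V,
      (∀ X : Set V, s ∈ X → t ∉ X → f + y ≤ cutSize H X + cutSize F X + k + cutSize B X) →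
      graphOfList g ≤ B ∧ ∀ X : Set V, s ∈ X → t ∉ X →
        f + y ≤ cutSize H X + cutSize F X + k + cutSize (graphOfList g) X := by
    intro B F
    by_cases h : ∀ X : Set V, s ∈ X → t ∉ X →
        f + y ≤ cutSize H X + cutSize F X + k + cutSize B X
    · obtain ⟨F', hFB, hF, hcard⟩ := exists_sparse_augmentation s t
        (fun X => cutSize H X + cutSize F X + k)
        (((cutSize_submodular H).add (cutSize_submodular F)).add (IsSubmodular.const k)) B
        (f + y) k h fun X h1 h2 => by have := hH X h1 h2; omega
      obtain ⟨g, rfl⟩ := exists_graphOfList_eq F' hcard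
      exact ⟨g, fun _ => ⟨hFB, hF⟩⟩
    · exact ⟨fun _ => (s, s), fun h' => absurd h' h⟩
  choose cb hcb using hB
  have : Nonempty (Fin M → V × V) := ⟨fun _ => (s, s)⟩
  have : Nonempty (Fin (2 * b) → ClusterSketch V) := ⟨sk ⊥⟩
  have hbobs : ∀ g : Fin M → V × V,
      ∃ P : CommProtocol (SimpleGraph V) (SimpleGraph V) (SimpleGraph V),
      P.cost ≤ 2 * b * M + 0 ∧ ∀ GA GB, P.run GA GB =
        H ⊔ graphOfList g ⊔ graphOfList (cb (GB \ H) (graphOfList g)) := fun g =>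
    CommProtocol.exists_bob_send (2 * b * M) (card_graph_code_le M b hb.le)
      (fun GB => cb (GB \ H) (graphOfList g))
      (fun g' => .output (H ⊔ graphOfList g ⊔ graphOfList g')) 0 fun _ => le_rfl
  choose P1 hP1 hrun1 using hbobs
  have halice : ∀ σ : Fin (2 * b) → ClusterSketch V,
      ∃ P : CommProtocol (SimpleGraph V) (SimpleGraph V) (SimpleGraph V),
      P.cost ≤ 2 * b * M + (2 * b * M + 0) ∧ ∀ GA GB, P.run GA GB =
        (P1 (ca (GA \ H) σ)).run GA GB := fun σ =>
    CommProtocol.exists_alice_send (2 * b * M) (card_graph_code_le M b hb.le)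
      (fun GA => ca (GA \ H) σ) P1 _ hP1
  choose P2 hP2 hrun2 using halice
  obtain ⟨P, hP, hrun⟩ := CommProtocol.exists_bob_send (2 * b * Fintype.card V * (2 * b))
    (card_sketch_le (V := V) (2 * b) b hb.le) (fun GB => sk (GB \ H)) P2 _ hP2
  refine ⟨P, hP, fun GA GB hle hG => ?_⟩
  rw [hrun, hrun2, hrun1]
  set σ := sk (GB \ H) with hσ
  set FA := graphOfList (ca (GA \ H) σ) with hFA
  set FB := graphOfList (cb (GB \ H) FA) with hFB
  obtain ⟨hFA_le, hFA_cut⟩ := hca (GA \ H) σ fun X h1 h2 => by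
    have e1 := hG X h1 h2
    have e2 : cutSize (GA ⊔ GB) X ≤ cutSize (H ⊔ (GA \ H) ⊔ (GB \ H)) X := by
      refine cutSize_mono ?_ X
      rw [sup_assoc, ← sup_sdiff, sup_sdiff_self_right]
      exact le_sup_right
    have e3 := cutSize_sup_le (H ⊔ (GA \ H)) (GB \ H) X
    have e4 := cutSize_sup_le H (GA \ H) X
    have e5 : cutSize (GB \ H) X ≤ sketchEval σ X := (hsk (GB \ H) X).1
    omega
  obtain ⟨hFB_le, hFB_cut⟩ := hcb (GB \ H) FA fun X h1 h2 => by
    have e1 : f ≤ cutSize H X + sketchEval σ X + cutSize FA X := hFA_cut X h1 h2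
    have e2 : sketchEval σ X ≤ 8 * b * cutSize (GB \ H) X := (hsk (GB \ H) X).2
    have e3 := hH X h1 h2
    -- The excess of `H` over `f - k`, plus `FA`, plus `8 * b` times Bob's cut, is at least `k`;
    -- dividing by `8 * b` gives the claim.
    have e4 : y ≤ (cutSize H X + k - f) + cutSize FA X + cutSize (GB \ H) X := by
      refine hyb _ ?_
      have e5 : cutSize H X + k - f + cutSize FA X ≤
        8 * b * (cutSize H X + k - f + cutSize FA X) := Nat.le_mul_of_pos_left _ (by omega)
      rw [Nat.mul_add]
      omega
    omega
  refine ⟨sup_le (sup_le hle ?_) ?_, ?_⟩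
  · exact hFA_le.trans (sdiff_le.trans le_sup_left)
  · exact hFB_le.trans (sdiff_le.trans le_sup_right)
  · intro X h1 h2
    have e1 : f + y ≤ cutSize H X + cutSize FA X + k + cutSize FB X := hFB_cut X h1 h2
    have e2 := hH X h1 h2
    -- `FA` and `FB` are each disjoint from `H` but perhaps not from each other, so the union is
    -- bounded below by `H` plus either one. Adding the two bounds yields half of `y`.
    have dA : Disjoint H FA := disjoint_sdiff_self_right.mono_right hFA_le
    have dB : Disjoint H FB := disjoint_sdiff_self_right.mono_right hFB_le
    have e3 := (cutSize_add_le_sup dA X).trans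
      (cutSize_mono (le_sup_left : H ⊔ FA ≤ H ⊔ FA ⊔ FB) X)
    have e4 := (cutSize_add_le_sup dB X).trans
      (cutSize_mono (sup_le_sup_right le_sup_left FB : H ⊔ FB ≤ H ⊔ FA ⊔ FB) X)
    set d := cutSize (H ⊔ FA ⊔ FB) X with hd
    by_cases hdf : f ≤ d
    · exact hdf.trans (Nat.le_add_right _ _)
    have e5 : f - d ≤ k * (16 * b - 1) / (16 * b) := by
      rw [Nat.le_div_iff_mul_le (by omega)]
      obtain ⟨x, hx⟩ : ∃ x, f = d + x := ⟨f - d, by omega⟩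
      obtain ⟨z, hz⟩ : ∃ z, k = x + z := ⟨k - x, by omega⟩
      obtain ⟨a, ha⟩ : ∃ a, 16 * b = a + 1 := ⟨16 * b - 1, by omega⟩
      have e6 : y ≤ 2 * z := by omega
      have e7 : k ≤ 16 * b * z :=
        hyb'.trans ((Nat.mul_le_mul_left _ e6).trans_eq (by ring))
      have e8 : f - d = x := by omega
      rw [e8, ha, Nat.add_sub_cancel]
      rw [ha] at e7
      rw [hz] at e7 ⊢
      nlinarith
    omega

theorem canImprove_iterate {V : Type*} [Fintype V] (s t : V) (f b : ℕ) (hb0 : 0 < b)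
    (hb : Fintype.card V < 2 ^ b) (K : ℕ) (T : ℕ) : ∀ k ≤ K,
    CanImprove s t f (T * stepCost (Fintype.card V) b K) k
      ((fun k => k * (16 * b - 1) / (16 * b))^[T] k) := by
  induction T with
  | zero =>
    intro k _
    simpa using CanImprove.refl s t f k
  | succ T ih =>
    intro k hk
    have h1 := canImprove_step s t f k b hb0 hb
    have h2 := ih (k * (16 * b - 1) / (16 * b)) (by
      refine le_trans (Nat.div_le_of_le_mul ?_) hk
      rw [mul_comm]
      exact Nat.mul_le_mul_right _ (Nat.sub_le _ _))
    have h3 := h1.trans h2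
    intro H hH
    obtain ⟨P, hP, hrun⟩ := h3 H hH
    refine ⟨P, hP.trans ?_, hrun⟩
    have : stepCost (Fintype.card V) b k ≤ stepCost (Fintype.card V) b K := by
      have := Nat.sqrt_le_sqrt hk
      unfold stepCost
      gcongr
    rw [Nat.succ_mul]
    omega

/-- Since `(1 - 1/a) ^ a ≤ 1/2`, each block of `a` rounds halves the deficit; after `m` blocks it is
below one, hence zero by integrality. -/
theorem iterate_mul_div_eq_zero (a m k : ℕ) (ha : 0 < a) (hk : k < 2 ^ m) :
    (fun k => k * (a - 1) / a)^[a * m] k = 0 := by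
  have h1 : ∀ T k, (fun k => k * (a - 1) / a)^[T] k * a ^ T ≤ k * (a - 1) ^ T := by
    intro T
    induction T with
    | zero => intro k; simp
    | succ T ih =>
      intro k
      rw [Function.iterate_succ_apply]
      calc _ = (fun k => k * (a - 1) / a)^[T] (k * (a - 1) / a) * a ^ T * a := by ring
        _ ≤ k * (a - 1) / a * (a - 1) ^ T * a := Nat.mul_le_mul_right _ (ih _)
        _ = (k * (a - 1) / a * a) * (a - 1) ^ T := by ring
        _ ≤ k * (a - 1) * (a - 1) ^ T := Nat.mul_le_mul_right _ (Nat.div_mul_le_self _ _)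
        _ = _ := by ring
  have h2 : 2 * (a - 1) ^ a ≤ a ^ a := by
    obtain ⟨c, rfl⟩ : ∃ c, a = c + 1 := ⟨a - 1, by omega⟩
    rw [Nat.add_sub_cancel]
    -- Two leading terms of the binomial expansion.
    have h3 : ∀ m, c ^ (m + 1) + (m + 1) * c ^ m ≤ (c + 1) ^ (m + 1) := by
      intro m
      induction m with
      | zero => simp
      | succ m ih =>
        calc c ^ (m + 1 + 1) + (m + 1 + 1) * c ^ (m + 1)
            ≤ c ^ (m + 1 + 1) + (m + 1 + 1) * c ^ (m + 1) + (m + 1) * c ^ m :=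
              Nat.le_add_right _ _
          _ = (c ^ (m + 1) + (m + 1) * c ^ m) * (c + 1) := by ring
          _ ≤ (c + 1) ^ (m + 1 + 1) := Nat.mul_le_mul_right _ ih
    calc 2 * c ^ (c + 1) ≤ c ^ (c + 1) + (c + 1) * c ^ c := by ring_nf; omega
      _ ≤ _ := h3 c
  have h4 := h1 (a * m) k
  by_contra hne
  have h5 : (a - 1) ^ (a * m) * 2 ^ m ≤ a ^ (a * m) := by
    rw [pow_mul, pow_mul, ← mul_pow]
    exact Nat.pow_le_pow_left (by rw [mul_comm]; exact h2) _
  have h6 : 1 ≤ (fun k => k * (a - 1) / a)^[a * m] k := by omega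
  have h7 : a ^ (a * m) ≤ k * (a - 1) ^ (a * m) :=
    (Nat.le_mul_of_pos_left _ h6).trans h4
  have h8 : 0 < a ^ (a * m) := Nat.pow_pos ha
  have h9 : 0 < (a - 1) ^ (a * m) := by
    by_contra h
    have : (a - 1) ^ (a * m) = 0 := by omega
    rw [this] at h7
    omega
  nlinarith

/-- There are `16 * b ^ 2` rounds of at most `36 * b ^ 2 * n * √k` bits, with `b ≤ 3 * log n`, so
the constant is `16 * 36 * 3 ^ 4`. The factor `f / k'` enters only through `k' ≤ f`. -/
theorem cost_bound {n f k k' b : ℕ} (hn : 2 ≤ n) (hk' : 0 < k') (hkk : k' < k) (hkf : k ≤ f)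
    (hb : b = Nat.log 2 n + 1) :
    ((16 * b * b * stepCost n b k : ℕ) : ℝ) ≤
      46656 * ((n : ℝ) * f * (√(k : ℝ) / k')) * Real.log n ^ 4 := by
  have hlog : (b : ℝ) ≤ 3 * Real.log n := by
    have h1 : ((Nat.log 2 n : ℕ) : ℝ) * Real.log 2 ≤ Real.log n := by
      rw [← Real.log_pow]
      refine Real.log_le_log (by positivity) ?_
      exact_mod_cast Nat.pow_log_le_self 2 (by omega)
    have h2 : Real.log 2 ≤ Real.log n :=
      Real.log_le_log (by norm_num) (by exact_mod_cast hn)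
    have h3 := Real.log_two_gt_d9
    have h4 : (1 : ℝ) ≤ (Nat.log 2 n : ℕ) := by
      exact_mod_cast Nat.log_pos (by norm_num) hn
    rw [hb]
    push_cast
    nlinarith
  have hb1 : (1 : ℝ) ≤ b := by
    rw [hb]; push_cast; linarith [(Nat.cast_nonneg (Nat.log 2 n) : (0 : ℝ) ≤ _)]
  have hs : ((Nat.sqrt k : ℕ) : ℝ) ≤ √(k : ℝ) := Real.nat_sqrt_le_real_sqrt
  have hk1 : (1 : ℝ) ≤ √(k : ℝ) := by
    rw [Real.one_le_sqrt]
    exact_mod_cast (by omega : 1 ≤ k)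
  have hn0 : (0 : ℝ) ≤ n := Nat.cast_nonneg n
  have hk0 : (0 : ℝ) < k' := by exact_mod_cast hk'
  have hfk : √(k : ℝ) ≤ f * (√(k : ℝ) / k') := by
    have : (k' : ℝ) ≤ f := by exact_mod_cast (hkk.le.trans hkf)
    rw [mul_div_assoc', le_div_iff₀ hk0]
    nlinarith
  have hstep : ((stepCost n b k : ℕ) : ℝ) ≤ 36 * (b : ℝ) ^ 2 * (n * √(k : ℝ)) := by
    have : ((stepCost n b k : ℕ) : ℝ) =
        4 * (b : ℝ) ^ 2 * n + 16 * b * (n * ((Nat.sqrt k : ℕ) + 1)) := by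
      unfold stepCost
      push_cast
      ring
    rw [this]
    have h1 : (n : ℝ) * ((Nat.sqrt k : ℕ) + 1) ≤ 2 * (n * √(k : ℝ)) := by nlinarith
    have h2 : (n : ℝ) ≤ n * √(k : ℝ) := by nlinarith
    have h3 : (b : ℝ) ≤ b ^ 2 := by nlinarith
    have h4 : (0 : ℝ) ≤ n * √(k : ℝ) := by positivity
    calc 4 * (b : ℝ) ^ 2 * n + 16 * b * (n * ((Nat.sqrt k : ℕ) + 1))
        ≤ 4 * (b : ℝ) ^ 2 * (n * √(k : ℝ)) + 16 * (b : ℝ) ^ 2 * (2 * (n * √(k : ℝ))) := by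
          gcongr
      _ = _ := by ring
  have hlog0 : 0 ≤ Real.log n := by linarith
  calc ((16 * b * b * stepCost n b k : ℕ) : ℝ) = 16 * (b : ℝ) ^ 2 * (stepCost n b k : ℕ) := by
        push_cast; ring
    _ ≤ 16 * (b : ℝ) ^ 2 * (36 * (b : ℝ) ^ 2 * (n * √(k : ℝ))) := by gcongr
    _ = 576 * (n * √(k : ℝ)) * (b : ℝ) ^ 4 := by ring
    _ ≤ 576 * (n * (f * (√(k : ℝ) / k'))) * (3 * Real.log n) ^ 4 := by gcongr
    _ = _ := by ring

theorem mainTheorem6 :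
    ∃ (C : ℝ) (d : ℕ), ∀ (V : Type*) [Fintype V] (s t : V), s ≠ t →
      ∀ f k k' : ℕ, 0 < k' → k' < k → k ≤ f →
      ∀ H : SimpleGraph V, f - k ≤ minCutValue H s t →
        ∃ P : CommProtocol (SimpleGraph V) (SimpleGraph V) (SimpleGraph V),
          (P.cost : ℝ) ≤ C * ((Fintype.card V : ℝ) * f * (√(k : ℝ) / k')) *
              Real.log (Fintype.card V) ^ d ∧
          ∀ GA GB : SimpleGraph V, H ≤ GA ⊔ GB → f ≤ minCutValue (GA ⊔ GB) s t →
            P.run GA GB ≤ GA ⊔ GB ∧ f - k' ≤ minCutValue (P.run GA GB) s t := by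
  refine ⟨46656, 4, fun V _ s t hst f k k' hk' hkk hkf H hH => ?_⟩
  have hn : 2 ≤ Fintype.card V := Fintype.one_lt_card_iff.2 ⟨s, t, hst⟩
  have hbound := cost_bound (n := Fintype.card V) hn hk' hkk hkf rfl
  set b := Nat.log 2 (Fintype.card V) + 1 with hb
  have hnb : Fintype.card V < 2 ^ b := Nat.lt_pow_succ_log_self (by norm_num) _
  -- Here `k ≤ f < n < 2 ^ b`, so `16 * b * b` rounds remove the whole deficit. Otherwise no input
  -- satisfies the promise and any output will do.
  by_cases hf : f < Fintype.card V
  · have h := canImprove_iterate s t f b (by omega) hnb k (16 * b * b) k le_rfl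
    rw [iterate_mul_div_eq_zero (16 * b) b k (by omega) (by omega)] at h
    obtain ⟨P, hP, hrun⟩ := h H fun X h1 h2 => by
      have := (le_minCutValue_iff H hst _).1 hH X h1 h2
      omega
    refine ⟨P, le_trans (by exact_mod_cast hP) hbound, fun GA GB hle hG => ?_⟩
    obtain ⟨h1, h2⟩ := hrun GA GB hle ((le_minCutValue_iff _ hst f).1 hG)
    exact ⟨h1, (Nat.sub_le _ _).trans ((le_minCutValue_iff _ hst f).2 h2)⟩
  · refine ⟨.output ⊥, le_trans (Nat.cast_le.2 (Nat.zero_le _)) hbound, fun GA GB _ hG => ?_⟩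
    have := minCutValue_lt_card (GA ⊔ GB) hst
    omega
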